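/- Let $(\mathbf{B},\|\cdot\|)$ be a real separable Banach space with its Borel $\sigma$-algebra, let $0<p<2$, and let $X, X_1, X_2,\dots$ be i.i.d. $\mathbf{B}$-valued random variables on a probability space $(\Omega,\mathcal F,\mathbb P)$. Put $S_n=\sum_{i=1}^n X_i$ and $$\bar\beta=-\limsup_{t\to\infty}\frac1t\log\mathbb P(\log\|X\|>t)\in[0,\infty],\qquad \underline\beta=-\liminf_{t\to\infty}\frac1t\log\mathbb P(\log\|X\|>t)\in[0,\infty],$$ with the conventions $\log 0=-\infty$ and $(\pm\infty+y)/x=\pm\infty$ for real $x>0$ and $y$. If $S_n/n^{1/p}\to 0$ in probability, then for every $s>0$ $$\limsup_{n\to\infty}\frac{1}{\log n}\log\mathbb P\left(\|S_n\|>s\,n^{1/p}\right)=-\frac{\bar\beta-p}{p}$$ and $$\liminf_{n\to\infty}\frac{1}{\log n}\log\mathbb P\left(\|S_n\|>s\,n^{1/p}\right)=-\frac{\underline\beta-p}{p}.$$ Hence, for every $s>0$ and every $\hat\beta\in[-\infty,\infty]$, the limit $\lim_{n\to\infty}\frac{1}{\log n}\log\mathbb P(\|S_n\|>s\,n^{1/p})$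 exists in $[-\infty,\infty]$ and equals $-(\hat\beta-p)/p$ if and only if $\bar\beta=\underline\beta=\hat\beta$. -/

import Mathlib

open Filter Topology MeasureTheory ProbabilityTheory

/-- The function `t ↦ (1/t) log ℙ(log ‖X‖ > t)` with values in `[-∞, ∞]`, where `log 0 = -∞` for the
outer logarithm. Only its behaviour as `t → ∞` matters; for `t ≥ 0` the event `log ‖X‖ > t` does not
contain any `ω` with `X ω = 0`, under either convention `Real.log 0 = 0` or `log 0 = -∞`. -/
noncomputable def logTailRate {Ω B : Type*} [MeasurableSpace Ω] [NormedAddCommGroup B]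
    (μ : Measure Ω) (X : Ω → B) (t : ℝ) : EReal :=
  ((1 / t : ℝ) : EReal) * ENNReal.log (μ {ω | Real.log ‖X ω‖ > t})

/-- The upper logarithmic tail exponent `- limsup_{t → ∞} (1/t) log ℙ(log ‖X‖ > t)`. -/
noncomputable def upperTailExponent {Ω B : Type*} [MeasurableSpace Ω] [NormedAddCommGroup B]
    (μ : Measure Ω) (X : Ω → B) : EReal :=
  -limsup (fun t : ℝ => logTailRate μ X t) atTop

/-- The lower logarithmic tail exponent `- liminf_{t → ∞} (1/t) log ℙ(log ‖X‖ > t)`. -/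
noncomputable def lowerTailExponent {Ω B : Type*} [MeasurableSpace Ω] [NormedAddCommGroup B]
    (μ : Measure Ω) (X : Ω → B) : EReal :=
  -liminf (fun t : ℝ => logTailRate μ X t) atTop

/-- The partial sum of the first `n` terms of a sequence of random variables; the sequence is indexed
from `0`, so that `Y i` is the `(i + 1)`-st variable. -/
def partialSum {Ω B : Type*} [AddCommMonoid B] (Y : ℕ → Ω → B) (n : ℕ) (ω : Ω) : B :=
  ∑ i ∈ Finset.range n, Y i ω

/-- The expression `(1 / log n) log ℙ(‖S_n‖ > s n^{1/p})` with values in `[-∞, ∞]`, where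
`log 0 = -∞` for the outer logarithm. -/
noncomputable def logDeviationRate {Ω B : Type*} [MeasurableSpace Ω] [NormedAddCommGroup B]
    (μ : Measure Ω) (Y : ℕ → Ω → B) (p s : ℝ) (n : ℕ) : EReal :=
  ((1 / Real.log n : ℝ) : EReal) *
    ENNReal.log (μ {ω | ‖partialSum Y n ω‖ > s * (n : ℝ) ^ (1 / p)})

/-! The principle is that of one big jump: on a logarithmic scale, `‖S_n‖ > s n^{1/p}` is as likely
as a single one of the `n` terms having norm about `n^{1/p}`. With `t = log n^{1/p}`, the quantity
`log (n ℙ(log ‖X‖ > t)) / log n` equals `1 + (1/p) (1/t) log ℙ(log ‖X‖ > t)`, and `1 - β/p = -(β -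
p)/p`. Constant factors, and arbitrarily small changes of the exponent `1/p`, disappear in the
limit.

Lower bound (`measureReal_sum_gt_lower_bound`): if one term exceeds `2r` while the sum of the others
stays below `r`, the sum exceeds `r`. A second moment argument on the number of such indices gives a
probability of order `n ℙ(‖X‖ > 2r)`. As the weak law makes the left side small, this also places
`X` in weak `L^p` (`exists_tail_le_rpow_neg`).

Upper bound (`measureReal_sum_gt_upper_bound`): truncate the terms at `b = n^{1/p - ε}`, at a cost
of at most `n ℙ(‖X‖ > b)`. Since `p < 2`, weak `L^p` controls the truncated second moments, and a
sub-Gaussian Laplace bound for Lipschitz functions concentrates the norm of the truncated sum around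
its mean. The weak law bounds that mean, so no assumption on the geometry of the space is needed.
The remaining error is smaller than any power of `n`. -/

/-! ### Concentration of Lipschitz functions of sums of bounded independent vectors. -/

/-- Fubini for a continuous function of two bounded independent random vectors. -/
theorem IndepFun.integral_comp_add_of_bounded {B Ω : Type*} [NormedAddCommGroup B]
    [SecondCountableTopology B] [MeasurableSpace B] [BorelSpace B] [MeasurableSpace Ω]
    {μ : Measure Ω} [IsProbabilityMeasure μ] {T Z : Ω → B} (hT : AEMeasurable T μ)
    (hZ : AEMeasurable Z μ) (hTZ : IndepFun T Z μ) {g : B → ℝ} (hg : Continuous g) {M : ℝ}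
    (hM : ∀ ω ω', |g (T ω + Z ω')| ≤ M) :
    ∫ ω, g (T ω + Z ω) ∂μ = ∫ ω, ∫ ω', g (T ω + Z ω') ∂μ ∂μ := by
  have hmap := (indepFun_iff_map_prod_eq_prod_map_map hT hZ).1 hTZ
  have hgm : Measurable fun q : B × B => g (q.1 + q.2) := by fun_prop
  have : IsProbabilityMeasure (μ.map T) := Measure.isProbabilityMeasure_map hT
  have : IsProbabilityMeasure (μ.map Z) := Measure.isProbabilityMeasure_map hZ
  have hint : Integrable (fun q : B × B => g (q.1 + q.2)) ((μ.map T).prod (μ.map Z)) := by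
    rw [← hmap]
    rw [integrable_map_measure hgm.aestronglyMeasurable (hT.prodMk hZ)]
    exact Integrable.of_bound (hgm.comp_aemeasurable (hT.prodMk hZ)).aestronglyMeasurable M
      (ae_of_all _ fun ω => hM ω ω)
  calc ∫ ω, g (T ω + Z ω) ∂μ
      = ∫ q, g (q.1 + q.2) ∂(μ.map fun ω => (T ω, Z ω)) :=
        (integral_map (hT.prodMk hZ) hgm.aestronglyMeasurable).symm
    _ = ∫ x, ∫ z, g (x + z) ∂(μ.map Z) ∂(μ.map T) := by rw [hmap, integral_prod _ hint]
    _ = ∫ ω, ∫ z, g (T ω + z) ∂(μ.map Z) ∂μ :=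
        integral_map hT hint.integral_prod_left.aestronglyMeasurable
    _ = _ := by
        refine integral_congr_ae (ae_of_all _ fun ω => ?_)
        exact integral_map hZ (by fun_prop)

/-- The exponential moment of a Lipschitz function of a bounded random vector. -/
theorem integral_exp_lipschitz_le {B Ω : Type*} [NormedAddCommGroup B]
    [SecondCountableTopology B] [MeasurableSpace B] [BorelSpace B] [MeasurableSpace Ω]
    {μ : Measure Ω} [IsProbabilityMeasure μ] {Z : Ω → B} (hZ : AEMeasurable Z μ) {b v l : ℝ}
    (hb : ∀ ω, ‖Z ω‖ ≤ b) (hv : ∫ ω, ‖Z ω‖ ^ 2 ∂μ ≤ v) (hl : |l| * b ≤ 1)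
    {F : B → ℝ} (hF : LipschitzWith 1 F) (x : B) :
    ∫ ω, Real.exp (l * F (x + Z ω)) ∂μ ≤
      Real.exp (l ^ 2 * v) * Real.exp (l * ∫ ω, F (x + Z ω) ∂μ) := by
  have hFc := hF.continuous
  have hd : ∀ ω, |F (x + Z ω) - F x| ≤ ‖Z ω‖ := fun ω => by
    have := hF.dist_le_mul (x + Z ω) x
    simpa [Real.dist_eq, dist_eq_norm] using this
  have hint1 : Integrable (fun ω => F (x + Z ω) - F x) μ :=
    Integrable.of_bound (((hFc.comp (continuous_const.add continuous_id)).measurable.comp_aemeasurable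
      hZ).sub_const _).aestronglyMeasurable b (ae_of_all _ fun ω => (hd ω).trans (hb ω))
  have hint2 : Integrable (fun ω => ‖Z ω‖ ^ 2) μ :=
    Integrable.of_bound (hZ.norm.pow_const 2).aestronglyMeasurable (b ^ 2)
      (ae_of_all _ fun ω => by
        rw [Real.norm_eq_abs, abs_of_nonneg (by positivity)]
        exact pow_le_pow_left₀ (norm_nonneg _) (hb ω) 2)
  -- The inequality `e^u ≤ 1 + u + u²` for `|u| ≤ 1`, with `u` the increment of `l F` at `x`. Its
  -- linear term is kept exactly, so that integration reproduces the mean of `F (x + Z)`.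
  have hpt : ∀ ω, Real.exp (l * F (x + Z ω)) ≤
      Real.exp (l * F x) * (1 + l * (F (x + Z ω) - F x) + l ^ 2 * ‖Z ω‖ ^ 2) := fun ω => by
    have hu : |l * (F (x + Z ω) - F x)| ≤ 1 := by
      rw [abs_mul]
      exact (mul_le_mul_of_nonneg_left ((hd ω).trans (hb ω)) (abs_nonneg _)).trans hl
    have h1 := (abs_le.1 (Real.abs_exp_sub_one_sub_id_le hu)).2
    have h2 : (l * (F (x + Z ω) - F x)) ^ 2 ≤ l ^ 2 * ‖Z ω‖ ^ 2 := by
      rw [mul_pow]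
      exact mul_le_mul_of_nonneg_left (sq_le_sq.2 (by simpa using hd ω)) (sq_nonneg _)
    rw [show l * F (x + Z ω) = l * F x + l * (F (x + Z ω) - F x) by ring, Real.exp_add]
    exact mul_le_mul_of_nonneg_left (by linarith) (Real.exp_pos _).le
  have hmean : ∫ ω, F (x + Z ω) ∂μ = (∫ ω, (F (x + Z ω) - F x) ∂μ) + F x := by
    have : Integrable (fun ω => F (x + Z ω)) μ := by
      refine (hint1.add (integrable_const (F x))).congr (ae_of_all _ fun ω => ?_)
      simp
    rw [integral_sub this (integrable_const _)]
    simp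
  have hint3 := ((integrable_const (1 : ℝ)).add (hint1.const_mul l)).add (hint2.const_mul (l ^ 2))
  calc ∫ ω, Real.exp (l * F (x + Z ω)) ∂μ
      ≤ ∫ ω, Real.exp (l * F x) * (1 + l * (F (x + Z ω) - F x) + l ^ 2 * ‖Z ω‖ ^ 2) ∂μ :=
        integral_mono_of_nonneg (ae_of_all _ fun ω => (Real.exp_pos _).le)
          (hint3.const_mul _) (ae_of_all _ hpt)
    _ = Real.exp (l * F x) *
        (1 + l * (∫ ω, (F (x + Z ω) - F x) ∂μ) + l ^ 2 * ∫ ω, ‖Z ω‖ ^ 2 ∂μ) := by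
        rw [integral_const_mul]
        congr 1
        rw [integral_add (f := fun ω => 1 + l * (F (x + Z ω) - F x))
          ((integrable_const (1 : ℝ)).add (hint1.const_mul l)) (hint2.const_mul (l ^ 2)),
          integral_add (integrable_const (1 : ℝ)) (hint1.const_mul l), integral_const_mul,
          integral_const_mul]
        simp
    _ ≤ Real.exp (l * F x) *
        Real.exp (l * (∫ ω, (F (x + Z ω) - F x) ∂μ) + l ^ 2 * v) := by
        refine mul_le_mul_of_nonneg_left ?_ (Real.exp_pos _).le
        refine le_trans ?_ (Real.add_one_le_exp _)
        have := mul_le_mul_of_nonneg_left hv (sq_nonneg l)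
        linarith
    _ = _ := by
        rw [← Real.exp_add, ← Real.exp_add, hmean]
        congr 1
        ring

/-- Sub-Gaussian bound, in the range `|l| b ≤ 1`, for the Laplace transform of a Lipschitz function
of a sum of independent random vectors bounded by `b`. -/
theorem integral_exp_lipschitz_sum_le {B Ω : Type*} [NormedAddCommGroup B]
    [SecondCountableTopology B] [MeasurableSpace B] [BorelSpace B] [MeasurableSpace Ω]
    {μ : Measure Ω} [IsProbabilityMeasure μ] {Z : ℕ → Ω → B} (hZ : ∀ i, AEMeasurable (Z i) μ)
    (hind : iIndepFun Z μ) {b v l : ℝ}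
    (hb : ∀ i ω, ‖Z i ω‖ ≤ b) (hv : ∀ i, ∫ ω, ‖Z i ω‖ ^ 2 ∂μ ≤ v) (hl : |l| * b ≤ 1) (n : ℕ) :
    ∀ F : B → ℝ, LipschitzWith 1 F →
    ∫ ω, Real.exp (l * F (partialSum Z n ω)) ∂μ ≤
      Real.exp (n * (l ^ 2 * v)) * Real.exp (l * ∫ ω, F (partialSum Z n ω) ∂μ) := by
  induction n with
  | zero => intro F hF; simp [partialSum]
  | succ n ih =>
    intro F hF
    have hT : AEMeasurable (partialSum Z n) μ := by
      unfold partialSum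
      fun_prop
    have hTb : ∀ ω, ‖partialSum Z n ω‖ ≤ n * b := fun ω => by
      refine (norm_sum_le _ _).trans ((Finset.sum_le_sum fun i _ => hb i ω).trans ?_)
      simp
    have hTZ : IndepFun (partialSum Z n) (Z n) μ := by
      have := hind.indepFun_sum_range_succ₀ hZ n
      convert this using 1
      ext ω
      simp [partialSum]
    have hFb : ∀ x, |F x| ≤ |F 0| + ‖x‖ := fun x => by
      have := hF.dist_le_mul x 0
      simp only [Real.dist_eq, dist_zero_right, NNReal.coe_one, one_mul] at this
      have h2 := abs_sub_abs_le_abs_sub (F x) (F 0)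
      linarith
    have hFTZ : ∀ ω ω', |F (partialSum Z n ω + Z n ω')| ≤ |F 0| + (n * b + b) := fun ω ω' =>
      (hFb _).trans (add_le_add_right ((norm_add_le _ _).trans (add_le_add (hTb ω) (hb n ω'))) _)
    have hsucc : ∀ ω, partialSum Z (n + 1) ω = partialSum Z n ω + Z n ω := fun ω => by
      simp [partialSum, Finset.sum_range_succ]
    -- Averaging `F` over the last summand gives another 1-Lipschitz function with the same mean
    -- along the sums. The induction therefore runs over all `F` at once, in place of a martingale
    -- decomposition.
    set G : B → ℝ := fun x => ∫ ω, F (x + Z n ω) ∂μ with hG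
    have hFi : ∀ x, Integrable (fun ω => F (x + Z n ω)) μ := fun x =>
      Integrable.of_bound ((hF.continuous.comp (continuous_const.add
        continuous_id)).measurable.comp_aemeasurable (hZ n)).aestronglyMeasurable
        (|F 0| + (‖x‖ + b)) (ae_of_all _ fun ω => (hFb _).trans
          (add_le_add_right ((norm_add_le _ _).trans (add_le_add_right (hb n ω) _)) _))
    have hGL : LipschitzWith 1 G := by
      refine LipschitzWith.of_dist_le_mul fun x y => ?_
      rw [Real.dist_eq, hG]
      simp only
      rw [← integral_sub (hFi x) (hFi y), ← Real.norm_eq_abs]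
      refine (norm_integral_le_of_norm_le_const (C := dist x y) (ae_of_all _ fun ω => ?_)).trans ?_
      · have := hF.dist_le_mul (x + Z n ω) (y + Z n ω)
        simpa [Real.dist_eq] using this
      · simp
    have hGb : ∀ ω, |G (partialSum Z n ω)| ≤ |F 0| + (n * b + b) := fun ω => by
      rw [← Real.norm_eq_abs]
      refine (norm_integral_le_of_norm_le_const (ae_of_all _ fun ω' => hFTZ ω ω')).trans ?_
      simp
    simp_rw [hsucc]
    have hexp := IndepFun.integral_comp_add_of_bounded hT (hZ n) hTZ
      (g := fun y => Real.exp (l * F y)) (by have := hF.continuous; fun_prop)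
      (M := Real.exp (|l| * (|F 0| + (n * b + b)))) (fun ω ω' => by
        rw [abs_of_pos (Real.exp_pos _)]
        refine Real.exp_le_exp.2 ((le_abs_self _).trans ?_)
        rw [abs_mul]
        exact mul_le_mul_of_nonneg_left (hFTZ ω ω') (abs_nonneg _))
    rw [hexp, IndepFun.integral_comp_add_of_bounded hT (hZ n) hTZ hF.continuous hFTZ]
    calc ∫ ω, ∫ ω', Real.exp (l * F (partialSum Z n ω + Z n ω')) ∂μ ∂μ
        ≤ ∫ ω, Real.exp (l ^ 2 * v) * Real.exp (l * G (partialSum Z n ω)) ∂μ := by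
          refine integral_mono_of_nonneg
            (ae_of_all _ fun ω => integral_nonneg fun _ => (Real.exp_pos _).le) ?_
            (ae_of_all _ fun ω => integral_exp_lipschitz_le (hZ n) (hb n) (hv n) hl hF _)
          refine Integrable.const_mul (Integrable.of_bound ?_
            (Real.exp (|l| * (|F 0| + (n * b + b)))) (ae_of_all _ fun ω => ?_)) _
          · have hc : Continuous fun y => Real.exp (l * G y) := by
              have := hGL.continuous; fun_prop
            exact (hc.measurable.comp_aemeasurable hT).aestronglyMeasurable
          · rw [Real.norm_eq_abs, abs_of_pos (Real.exp_pos _)]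
            refine Real.exp_le_exp.2 ((le_abs_self _).trans ?_)
            rw [abs_mul]
            exact mul_le_mul_of_nonneg_left (hGb ω) (abs_nonneg _)
      _ = Real.exp (l ^ 2 * v) * ∫ ω, Real.exp (l * G (partialSum Z n ω)) ∂μ :=
          integral_const_mul _ _
      _ ≤ Real.exp (l ^ 2 * v) *
          (Real.exp (n * (l ^ 2 * v)) * Real.exp (l * ∫ ω, G (partialSum Z n ω) ∂μ)) :=
          mul_le_mul_of_nonneg_left (ih G hGL) (Real.exp_pos _).le
      _ = _ := by
          rw [← mul_assoc, ← Real.exp_add]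
          congr 2
          push_cast
          ring

/-! ### Second moment lower bound and weak `L^p` tails. -/

/-- Lower bound for the tail of a norm of a sum by the tails of its terms. -/
theorem measureReal_sum_gt_lower_bound {B Ω : Type*} [NormedAddCommGroup B]
    [SecondCountableTopology B] [MeasurableSpace B] [BorelSpace B] [MeasurableSpace Ω]
    {μ : Measure Ω} [IsProbabilityMeasure μ] {Y : ℕ → Ω → B} (hY : ∀ i, Measurable (Y i))
    (hind : iIndepFun Y μ) {r v q : ℝ} (hq : 0 ≤ q) (n : ℕ)
    (hv : ∀ i, μ.real {ω | 2 * r < ‖Y i ω‖} = v)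
    (hqS : ∀ i ∈ Finset.range n, q ≤ μ.real {ω | ‖partialSum Y n ω - Y i ω‖ ≤ r}) :
    q ^ 2 * (n * v) / (1 + n * v) ≤ μ.real {ω | r < ‖partialSum Y n ω‖} := by
  have hv0 : 0 ≤ v := hv 0 ▸ measureReal_nonneg
  set A : ℕ → Set Ω := fun i => {ω | 2 * r < ‖Y i ω‖} with hA
  have hSm : Measurable (partialSum Y n) := by
    unfold partialSum; fun_prop
  have hAm : ∀ i, MeasurableSet (A i) := fun i => measurableSet_lt measurable_const (hY i).norm
  -- Term `i` is the big jump and the other terms do not compensate it. The two conditions are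
  -- independent.
  set D : ℕ → Set Ω := fun i => A i ∩ {ω | ‖partialSum Y n ω - Y i ω‖ ≤ r} with hD
  have hDm : ∀ i, MeasurableSet (D i) := fun i =>
    (hAm i).inter (measurableSet_le (hSm.sub (hY i)).norm measurable_const)
  set E : Set Ω := {ω | r < ‖partialSum Y n ω‖} with hE
  have hEm : MeasurableSet E := measurableSet_lt measurable_const hSm.norm
  have hDE : ∀ i, D i ⊆ E := fun i ω hω => by
    have h1 : 2 * r < ‖Y i ω‖ := hω.1
    have h2 : ‖partialSum Y n ω - Y i ω‖ ≤ r := hω.2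
    have h3 : ‖Y i ω‖ ≤ ‖partialSum Y n ω‖ + ‖partialSum Y n ω - Y i ω‖ := by
      have := norm_sub_le (partialSum Y n ω) (partialSum Y n ω - Y i ω)
      simpa using this
    change r < _
    linarith
  have hDP : ∀ i ∈ Finset.range n, q * v ≤ μ.real (D i) := fun i hi => by
    have hindep : IndepFun (∑ j ∈ (Finset.range n).erase i, Y j) (Y i) μ :=
      hind.indepFun_finsetSum_of_notMem hY (by simp)
    have heq : ∀ ω, (∑ j ∈ (Finset.range n).erase i, Y j) ω = partialSum Y n ω - Y i ω :=
      fun ω => by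
        rw [Finset.sum_apply, partialSum, ← Finset.add_sum_erase _ _ hi]
        simp
    have := hindep.measure_inter_preimage_eq_mul {x | ‖x‖ ≤ r} {x | 2 * r < ‖x‖}
      (measurableSet_le measurable_norm measurable_const)
      (measurableSet_lt measurable_const measurable_norm)
    simp only [Set.preimage_ofPred_eq, heq] at this
    have h2 : μ.real (D i) = μ.real {ω | ‖partialSum Y n ω - Y i ω‖ ≤ r} * v := by
      rw [hD]
      simp only
      rw [Set.inter_comm, measureReal_def, hA]
      simp only
      rw [this, ENNReal.toReal_mul, ← hv i]
      rfl
    rw [h2]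
    exact mul_le_mul_of_nonneg_right (hqS i hi) hv0
  have hDD : ∀ i j, μ.real (D i ∩ D j) ≤ (if i = j then v else 0) + v ^ 2 := fun i j => by
    split_ifs with hij
    · refine le_trans (measureReal_mono (Set.inter_subset_left.trans Set.inter_subset_left)) ?_
      rw [hA]
      simp only
      rw [hv i]
      nlinarith [sq_nonneg v]
    · refine le_trans (measureReal_mono (Set.inter_subset_inter Set.inter_subset_left
        Set.inter_subset_left)) ?_
      have := (hind.indepFun hij).measure_inter_preimage_eq_mul {x | 2 * r < ‖x‖} {x | 2 * r < ‖x‖}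
        (measurableSet_lt measurable_const measurable_norm)
        (measurableSet_lt measurable_const measurable_norm)
      simp only [Set.preimage_ofPred_eq] at this
      rw [measureReal_def, hA]
      simp only
      rw [this, ENNReal.toReal_mul, ← measureReal_def, ← measureReal_def, hv i, hv j]
      nlinarith
  set N : Ω → ℝ := fun ω => ∑ i ∈ Finset.range n, (D i).indicator (fun _ => (1 : ℝ)) ω with hN
  have hNi : ∀ i, Integrable ((D i).indicator fun _ => (1 : ℝ)) μ := fun i =>
    (integrable_const (1 : ℝ)).indicator (hDm i)
  have hNN : ∀ ω, N ω ^ 2 = ∑ i ∈ Finset.range n, ∑ j ∈ Finset.range n,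
      (D i ∩ D j).indicator (fun _ => (1 : ℝ)) ω := fun ω => by
    rw [hN]
    simp only
    rw [sq, Finset.sum_mul_sum]
    refine Finset.sum_congr rfl fun i _ => Finset.sum_congr rfl fun j _ => ?_
    by_cases h1 : ω ∈ D i <;> by_cases h2 : ω ∈ D j <;> simp [h1, h2]
  have hNint : Integrable N μ := integrable_finsetSum _ fun i _ => hNi i
  have hIij : ∀ i j, Integrable ((D i ∩ D j).indicator fun _ => (1 : ℝ)) μ := fun i j =>
    (integrable_const (1 : ℝ)).indicator ((hDm i).inter (hDm j))
  have hN2int : Integrable (fun ω => N ω ^ 2) μ := by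
    simp_rw [hNN]
    exact integrable_finsetSum _ fun i _ => integrable_finsetSum _ fun j _ => hIij i j
  have hEN : n * v * q ≤ ∫ ω, N ω ∂μ := by
    rw [hN, integral_finsetSum _ fun i _ => hNi i]
    calc n * v * q = ∑ i ∈ Finset.range n, q * v := by simp; ring
      _ ≤ _ := by
        refine Finset.sum_le_sum fun i hi => ?_
        rw [integral_indicator (hDm i)]
        simpa using hDP i hi
  have hEN2 : ∫ ω, N ω ^ 2 ∂μ ≤ n * v + (n * v) ^ 2 := by
    simp_rw [hNN]
    rw [integral_finsetSum _ fun i _ => integrable_finsetSum _ fun j _ => hIij i j]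
    calc _ ≤ ∑ i ∈ Finset.range n, ∑ j ∈ Finset.range n, ((if i = j then v else 0) + v ^ 2) := by
          refine Finset.sum_le_sum fun i _ => ?_
          rw [integral_finsetSum _ fun j _ => hIij i j]
          refine Finset.sum_le_sum fun j _ => ?_
          rw [integral_indicator ((hDm i).inter (hDm j))]
          simpa using hDD i j
      _ ≤ ∑ i ∈ Finset.range n, (v + n * v ^ 2) := by
          refine Finset.sum_le_sum fun i hi => ?_
          rw [Finset.sum_add_distrib, Finset.sum_ite_eq, if_pos hi]
          simp
      _ = _ := by simp; ring
  have hnv : 0 ≤ n * v := by positivity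
  -- On `E`, `1 - 2cN + c²N² = (1 - cN)² ≥ 0`; off `E` the count `N` vanishes. This `c` maximizes
  -- the bound `2c (nvq) - c² (nv + (nv)²)` that results from the two moment estimates.
  set c : ℝ := q / (1 + n * v) with hc
  have hc0 : 0 ≤ c := by positivity
  have hpt : ∀ ω, 2 * c * N ω - c ^ 2 * N ω ^ 2 ≤ E.indicator (fun _ => (1 : ℝ)) ω := fun ω => by
    by_cases hω : ω ∈ E
    · rw [Set.indicator_of_mem hω]
      nlinarith [sq_nonneg (1 - c * N ω)]
    · have : N ω = 0 := Finset.sum_eq_zero fun i _ =>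
        Set.indicator_of_notMem (fun h => hω (hDE i h)) _
      rw [Set.indicator_of_notMem hω, this]
      simp
  have hfin := integral_mono ((hNint.const_mul (2 * c)).sub (hN2int.const_mul (c ^ 2)))
    ((integrable_const (1 : ℝ)).indicator hEm) hpt
  rw [integral_indicator hEm] at hfin
  simp only [Pi.sub_apply] at hfin
  rw [integral_sub (hNint.const_mul (2 * c)) (hN2int.const_mul (c ^ 2)), integral_const_mul,
    integral_const_mul] at hfin
  simp only [integral_const, MeasurableSet.univ, measureReal_restrict_apply, Set.univ_inter,
    smul_eq_mul, mul_one] at hfin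
  refine le_trans ?_ hfin
  have h1 := mul_le_mul_of_nonneg_left hEN (by positivity : 0 ≤ 2 * c)
  have h2 := mul_le_mul_of_nonneg_left hEN2 (sq_nonneg c)
  have h3 : q ^ 2 * (n * v) / (1 + n * v) =
      2 * c * (n * v * q) - c ^ 2 * (n * v + (n * v) ^ 2) := by
    rw [hc]
    field_simp
    ring
  linarith

theorem tendsto_measureReal_norm_gt_atTop {B Ω : Type*} [NormedAddCommGroup B]
    [MeasurableSpace B] [BorelSpace B] [MeasurableSpace Ω]
    {μ : Measure Ω} [IsProbabilityMeasure μ] {Z : Ω → B} (hZ : Measurable Z) :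
    Tendsto (fun t : ℝ => μ.real {ω | t < ‖Z ω‖}) atTop (𝓝 0) := by
  have h := tendsto_measure_iInter_atTop (μ := μ) (s := fun t : ℝ => {ω | t < ‖Z ω‖})
    (fun t => (measurableSet_lt measurable_const hZ.norm).nullMeasurableSet)
    (fun a b hab ω hω => lt_of_le_of_lt hab hω) ⟨0, measure_ne_top _ _⟩
  have he : (⋂ t : ℝ, {ω | t < ‖Z ω‖}) = ∅ := by
    ext ω
    simp only [Set.mem_iInter, Set.mem_ofPred_eq, Set.mem_empty_iff_false, iff_false, not_forall]
    exact ⟨‖Z ω‖, lt_irrefl _⟩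
  rw [he, measure_empty] at h
  exact (ENNReal.tendsto_toReal ENNReal.zero_ne_top).comp h

/-- Under the weak law with normalization `n ^ (1 / p)`, the tail of the sum dominates
`n` times the tail of a single term, up to constants. -/
theorem eventually_tail_le_sum_tail {B Ω : Type*} [NormedAddCommGroup B]
    [SecondCountableTopology B] [MeasurableSpace B] [BorelSpace B] [MeasurableSpace Ω]
    {μ : Measure Ω} [IsProbabilityMeasure μ] {Y : ℕ → Ω → B} (hY : ∀ i, Measurable (Y i))
    (hind : iIndepFun Y μ) {V : ℝ → ℝ} (hV : ∀ i t, μ.real {ω | t < ‖Y i ω‖} = V t)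
    {p : ℝ} (hp : 0 < p)
    (hlln : ∀ s : ℝ, 0 < s → Tendsto (fun n : ℕ =>
      μ.real {ω | s * (n : ℝ) ^ (1 / p) < ‖partialSum Y n ω‖}) atTop (𝓝 0))
    {s : ℝ} (hs : 0 < s) :
    ∀ᶠ n : ℕ in atTop, n * V (2 * s * (n : ℝ) ^ (1 / p)) ≤ 1 ∧
      n * V (2 * s * (n : ℝ) ^ (1 / p)) / 8 ≤
        μ.real {ω | s * (n : ℝ) ^ (1 / p) < ‖partialSum Y n ω‖} := by
  have ha : Tendsto (fun n : ℕ => s / 2 * (n : ℝ) ^ (1 / p)) atTop atTop :=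
    ((tendsto_rpow_atTop (by positivity)).comp tendsto_natCast_atTop_atTop).const_mul_atTop
      (by positivity)
  have hV0 : Tendsto V atTop (𝓝 0) := by
    have := tendsto_measureReal_norm_gt_atTop (μ := μ) (hY 0)
    simpa only [hV 0] using this
  filter_upwards [(hlln s hs).eventually_lt_const (by norm_num : (0 : ℝ) < 1 / 8),
    (hlln (s / 2) (by positivity)).eventually_lt_const (by norm_num : (0 : ℝ) < 1 / 4),
    (hV0.comp ha).eventually_lt_const (by norm_num : (0 : ℝ) < 1 / 4)] with n h1 h2 h3
  set a : ℝ := (n : ℝ) ^ (1 / p) with hadef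
  have hq : ∀ i ∈ Finset.range n, 1 / 2 ≤ μ.real {ω | ‖partialSum Y n ω - Y i ω‖ ≤ s * a} := by
    intro i _
    have hSm : Measurable (partialSum Y n) := by
      unfold partialSum; fun_prop
    have hm : MeasurableSet {ω | ‖partialSum Y n ω - Y i ω‖ ≤ s * a} :=
      measurableSet_le (hSm.sub (hY i)).norm measurable_const
    have hcompl := probReal_compl_eq_one_sub (μ := μ) hm
    have hle : μ.real {ω | ‖partialSum Y n ω - Y i ω‖ ≤ s * a}ᶜ ≤
        μ.real {ω | s / 2 * a < ‖partialSum Y n ω‖} + μ.real {ω | s / 2 * a < ‖Y i ω‖} := by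
      refine le_trans (measureReal_mono ?_) (measureReal_union_le _ _)
      intro ω hω
      simp only [Set.mem_compl_iff, Set.mem_ofPred_eq, not_le] at hω
      by_contra hcon
      simp only [Set.mem_union, Set.mem_ofPred_eq, not_or, not_lt] at hcon
      have := norm_sub_le (partialSum Y n ω) (Y i ω)
      linarith [hcon.1, hcon.2]
    rw [hV i] at hle
    simp only [Function.comp_apply] at h3
    linarith
  have key := measureReal_sum_gt_lower_bound (r := s * a) hY hind (by norm_num : (0 : ℝ) ≤ 1 / 2) n
    (fun i => hV i _) hq
  rw [show 2 * (s * a) = 2 * s * a by ring] at key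
  have hv0 : 0 ≤ V (2 * s * a) := hV 0 _ ▸ measureReal_nonneg
  have hx0 : 0 ≤ n * V (2 * s * a) := by positivity
  generalize hx : n * V (2 * s * a) = x at *
  -- With `q = 1/2`, `key` and `h1` give `x / (4 (1 + x)) < 1/8`, which forces `x < 1`; then `4 (1 +
  -- x) ≤ 8` yields the factor `1/8`.
  have hx1 : x ≤ 1 := by
    have := key.trans_lt h1
    rw [div_lt_iff₀ (by positivity)] at this
    linarith
  refine ⟨hx1, le_trans ?_ key⟩
  rw [le_div_iff₀ (by positivity)]
  nlinarith

/-- Under the weak law with normalization `n ^ (1 / p)`, the terms are in weak `L^p`. -/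
theorem exists_tail_le_rpow_neg {B Ω : Type*} [NormedAddCommGroup B]
    [SecondCountableTopology B] [MeasurableSpace B] [BorelSpace B] [MeasurableSpace Ω]
    {μ : Measure Ω} [IsProbabilityMeasure μ] {Y : ℕ → Ω → B} (hY : ∀ i, Measurable (Y i))
    (hind : iIndepFun Y μ) {V : ℝ → ℝ} (hV : ∀ i t, μ.real {ω | t < ‖Y i ω‖} = V t)
    {p : ℝ} (hp : 0 < p)
    (hlln : ∀ s : ℝ, 0 < s → Tendsto (fun n : ℕ =>
      μ.real {ω | s * (n : ℝ) ^ (1 / p) < ‖partialSum Y n ω‖}) atTop (𝓝 0)) :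
    ∃ C : ℝ, 0 < C ∧ ∀ t : ℝ, 0 < t → V t ≤ C * t ^ (-p) := by
  obtain ⟨n₀, hn₀⟩ := eventually_atTop.1 (eventually_tail_le_sum_tail hY hind hV hp hlln
    (by norm_num : (0 : ℝ) < 1 / 2))
  -- For `t ^ p ≤ n₀ + 1` the trivial bound `V t ≤ 1` suffices; for larger `t`, taking `n = ⌊t ^ p⌋`
  -- gives `n V t ≤ 1` and `t ^ p ≤ 2 n`.
  refine ⟨n₀ + 2, by positivity, fun t ht => ?_⟩
  have hV1 : V t ≤ 1 := hV 0 t ▸ measureReal_le_one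
  have htp : 0 < t ^ p := Real.rpow_pos_of_pos ht p
  rw [Real.rpow_neg ht.le, ← div_eq_mul_inv, le_div_iff₀ htp]
  rcases le_or_gt (t ^ p) (n₀ + 1) with h | h
  · nlinarith [mul_le_mul_of_nonneg_right hV1 htp.le]
  · set n : ℕ := ⌊t ^ p⌋₊ with hn
    have hn1 : n₀ + 1 ≤ n := Nat.le_floor (by push_cast; exact h.le)
    have hnt : (n : ℝ) ≤ t ^ p := Nat.floor_le htp.le
    have hnt2 : t ^ p < n + 1 := Nat.lt_floor_add_one _
    have h1 := (hn₀ n (by omega)).1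
    have hle : (n : ℝ) ^ (1 / p) ≤ t := by
      calc (n : ℝ) ^ (1 / p) ≤ (t ^ p) ^ (1 / p) :=
            Real.rpow_le_rpow (Nat.cast_nonneg _) hnt (by positivity)
        _ = t := by rw [← Real.rpow_mul ht.le, mul_one_div_cancel hp.ne', Real.rpow_one]
    have hmono : V t ≤ V (2 * (1 / 2) * (n : ℝ) ^ (1 / p)) := by
      rw [← hV 0, ← hV 0]
      refine measureReal_mono fun ω hω => ?_
      simp only [Set.mem_ofPred_eq] at hω ⊢
      linarith
    have hV0 : 0 ≤ V t := hV 0 _ ▸ measureReal_nonneg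
    have hnr : (1 : ℝ) ≤ n := by exact_mod_cast (by omega : 1 ≤ n)
    have hn00 : (0 : ℝ) ≤ n₀ := Nat.cast_nonneg _
    calc V t * t ^ p ≤ V t * (2 * n) := mul_le_mul_of_nonneg_left (by linarith) hV0
      _ ≤ 2 * (n * V (2 * (1 / 2) * (n : ℝ) ^ (1 / p))) := by nlinarith
      _ ≤ _ := by linarith

/-! ### Truncation and the upper bound for the tail of the sum. -/

/-- The map equal to the identity on the closed ball of radius `b`, and to zero outside of it. -/
noncomputable def truncNorm {B : Type*} [NormedAddCommGroup B] (b : ℝ) : B → B :=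
  (Metric.closedBall (0 : B) b).indicator id

theorem truncNorm_of_le {B : Type*} [NormedAddCommGroup B] {b : ℝ} {x : B} (h : ‖x‖ ≤ b) :
    truncNorm b x = x := by
  rw [truncNorm, Set.indicator_of_mem (by simpa using h)]
  rfl

theorem truncNorm_of_lt {B : Type*} [NormedAddCommGroup B] {b : ℝ} {x : B} (h : b < ‖x‖) :
    truncNorm b x = 0 := by
  rw [truncNorm, Set.indicator_of_notMem (by simpa using h)]

theorem norm_truncNorm_le {B : Type*} [NormedAddCommGroup B] {b : ℝ} (hb : 0 ≤ b) (x : B) :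
    ‖truncNorm b x‖ ≤ b := by
  rcases le_or_gt ‖x‖ b with h | h
  · rwa [truncNorm_of_le h]
  · simpa [truncNorm_of_lt h] using hb

theorem norm_truncNorm_le_norm {B : Type*} [NormedAddCommGroup B] (b : ℝ) (x : B) :
    ‖truncNorm b x‖ ≤ ‖x‖ := by
  rcases le_or_gt ‖x‖ b with h | h
  · rw [truncNorm_of_le h]
  · simp [truncNorm_of_lt h]

theorem measurable_truncNorm {B : Type*} [NormedAddCommGroup B] [MeasurableSpace B] [BorelSpace B]
    (b : ℝ) : Measurable (truncNorm b : B → B) :=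
  measurable_id.indicator Metric.isClosed_closedBall.measurableSet

/-- The truncated second moment of a random vector in weak `L^p`, `p < 2`. -/
theorem integral_norm_truncNorm_sq_le {B Ω : Type*} [NormedAddCommGroup B]
    [MeasurableSpace B] [BorelSpace B] [MeasurableSpace Ω]
    {μ : Measure Ω} [IsProbabilityMeasure μ] {Z : Ω → B} (hZ : Measurable Z) {p C : ℝ}
    (hp2 : p < 2) (hC : 0 ≤ C)
    (htail : ∀ t : ℝ, 0 < t → μ.real {ω | t < ‖Z ω‖} ≤ C * t ^ (-p)) {b : ℝ} (hb : 0 ≤ b) :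
    ∫ ω, ‖truncNorm b (Z ω)‖ ^ 2 ∂μ ≤ 2 * C / (2 - p) * b ^ (2 - p) := by
  have hTm : Measurable fun ω => ‖truncNorm b (Z ω)‖ := ((measurable_truncNorm b).comp hZ).norm
  have hlay := lintegral_rpow_eq_lintegral_meas_lt_mul μ
    (ae_of_all _ fun ω => norm_nonneg (truncNorm b (Z ω))) hTm.aemeasurable two_pos
  -- After the layer cake formula, `p < 2` is what makes `t ^ (1 - p)` integrable at `0`.
  have hint : IntervalIntegrable (fun t : ℝ => C * t ^ (1 - p)) volume 0 b :=
    (intervalIntegral.intervalIntegrable_rpow' (by linarith)).const_mul C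
  have hpow : 0 ≤ 2 * C / (2 - p) * b ^ (2 - p) := by
    have : 0 ≤ 2 - p := by linarith
    positivity
  have hbound : ∫⁻ t in Set.Ioi (0 : ℝ), μ {ω | t < ‖truncNorm b (Z ω)‖} *
      ENNReal.ofReal (t ^ ((2 : ℝ) - 1)) ≤ ENNReal.ofReal (C * (b ^ (2 - p) / (2 - p))) := by
    calc _ ≤ ∫⁻ t in Set.Ioi (0 : ℝ), (Set.Ioc (0 : ℝ) b).indicator
            (fun t => ENNReal.ofReal (C * t ^ (1 - p))) t := by
          refine setLIntegral_mono' measurableSet_Ioi fun t ht => ?_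
          have ht0 : 0 < t := ht
          rcases le_or_gt t b with htb | htb
          · rw [Set.indicator_of_mem (show t ∈ Set.Ioc 0 b from ⟨ht0, htb⟩)]
            have h1 : μ {ω | t < ‖truncNorm b (Z ω)‖} ≤ ENNReal.ofReal (C * t ^ (-p)) := by
              rw [← ofReal_measureReal (measure_ne_top _ _)]
              refine ENNReal.ofReal_le_ofReal ((measureReal_mono fun ω hω => ?_).trans (htail t ht0))
              exact lt_of_lt_of_le hω (norm_truncNorm_le_norm _ _)
            refine (mul_le_mul_left h1 _).trans ?_
            rw [← ENNReal.ofReal_mul (by positivity)]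
            refine ENNReal.ofReal_le_ofReal (le_of_eq ?_)
            rw [mul_assoc, ← Real.rpow_add ht0]
            congr 2
            ring
          · have : {ω | t < ‖truncNorm b (Z ω)‖} = ∅ := by
              ext ω
              simp only [Set.mem_ofPred_eq, Set.mem_empty_iff_false, iff_false, not_lt]
              exact (norm_truncNorm_le hb _).trans htb.le
            simp [this]
      _ = ∫⁻ t in Set.Ioc (0 : ℝ) b, ENNReal.ofReal (C * t ^ (1 - p)) := by
          rw [lintegral_indicator measurableSet_Ioc, Measure.restrict_restrict measurableSet_Ioc,
            Set.inter_eq_left.2 Set.Ioc_subset_Ioi_self]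
      _ = ENNReal.ofReal (∫ t in Set.Ioc (0 : ℝ) b, C * t ^ (1 - p)) := by
          rw [ofReal_integral_eq_lintegral_ofReal]
          · exact (intervalIntegrable_iff_integrableOn_Ioc_of_le hb).1 hint
          · refine (ae_restrict_iff' measurableSet_Ioc).2 (ae_of_all _ fun t ht => ?_)
            have := ht.1
            positivity
      _ ≤ _ := by
          refine ENNReal.ofReal_le_ofReal (le_of_eq ?_)
          rw [← intervalIntegral.integral_of_le hb, intervalIntegral.integral_const_mul,
            integral_rpow (Or.inl (by linarith)), show 1 - p + 1 = 2 - p by ring,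
            Real.zero_rpow (by linarith), sub_zero]
  rw [integral_eq_lintegral_of_nonneg_ae (ae_of_all _ fun ω => by positivity)
    (hTm.pow_const 2).aestronglyMeasurable]
  refine ENNReal.toReal_le_of_le_ofReal hpow ?_
  have h2 : ∀ ω, ENNReal.ofReal (‖truncNorm b (Z ω)‖ ^ 2) =
      ENNReal.ofReal (‖truncNorm b (Z ω)‖ ^ (2 : ℝ)) := fun ω => by
    rw [Real.rpow_two]
  simp_rw [h2]
  rw [hlay]
  refine (mul_le_mul_right hbound _).trans ?_
  rw [← ENNReal.ofReal_mul (by norm_num)]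
  refine ENNReal.ofReal_le_ofReal (le_of_eq ?_)
  ring

/-- A sum of independent random vectors whose norm is small with large probability has tails bounded
by those of its terms, up to an exponential error. -/
theorem measureReal_sum_gt_upper_bound {B Ω : Type*} [NormedAddCommGroup B]
    [SecondCountableTopology B] [MeasurableSpace B] [BorelSpace B] [MeasurableSpace Ω]
    {μ : Measure Ω} [IsProbabilityMeasure μ] {Y : ℕ → Ω → B} (hY : ∀ i, Measurable (Y i))
    (hind : iIndepFun Y μ) {b l v M r w : ℝ} (hb : 0 ≤ b) (hl : 0 < l) (hlb : l * b ≤ 1) (n : ℕ)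
    (hv : ∀ i, ∫ ω, ‖truncNorm b (Y i ω)‖ ^ 2 ∂μ ≤ v) (hM : n * (l ^ 2 * v) ≤ M)
    (hw : ∀ i, μ.real {ω | b < ‖Y i ω‖} = w) (hnw : n * w ≤ 1 / 8)
    (hr : μ.real {ω | r / 8 < ‖partialSum Y n ω‖} ≤ 1 / 8)
    (hr0 : 0 ≤ r) (hexp : Real.exp (M - l * r / 8) < 3 / 4) :
    μ.real {ω | r < ‖partialSum Y n ω‖} ≤ n * w + Real.exp (M - l * r / 8) := by
  set Z : ℕ → Ω → B := fun i ω => truncNorm b (Y i ω) with hZdef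
  have hZ : ∀ i, Measurable (Z i) := fun i => (measurable_truncNorm b).comp (hY i)
  have hZind : iIndepFun Z μ := hind.comp (fun _ => truncNorm b) fun _ => measurable_truncNorm b
  have hZb : ∀ i ω, ‖Z i ω‖ ≤ b := fun i ω => norm_truncNorm_le hb _
  have hTm : Measurable (partialSum Z n) := by
    unfold partialSum; fun_prop
  set U : Set Ω := ⋃ i ∈ Finset.range n, {ω | b < ‖Y i ω‖} with hU
  have hUP : μ.real U ≤ n * w := by
    refine (measureReal_biUnion_finset_le _ _).trans ?_
    simp [hw]
  have hTS : ∀ ω, ω ∉ U → partialSum Z n ω = partialSum Y n ω := fun ω hω => by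
    simp only [hU, Set.mem_iUnion, Set.mem_ofPred_eq, not_exists, not_lt] at hω
    exact Finset.sum_congr rfl fun i hi => truncNorm_of_le (hω i hi)
  set m : ℝ := ∫ ω, ‖partialSum Z n ω‖ ∂μ with hm
  -- Both signs are needed: `-l` bounds the mean `m` from above through the lower tail, and `l` then
  -- bounds the upper tail.
  have hmgf : ∀ l' : ℝ, |l'| = l → mgf (fun ω => ‖partialSum Z n ω‖) μ l' ≤
      Real.exp (M + l' * m) := fun l' hl' => by
    have h := integral_exp_lipschitz_sum_le (fun i => (hZ i).aemeasurable) hZind hZb hv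
      (l := l') (by rwa [hl']) n (fun x => ‖x‖) lipschitzWith_one_norm
    rw [mgf]
    refine h.trans ?_
    rw [← Real.exp_add]
    refine Real.exp_le_exp.2 (add_le_add_left ?_ _)
    rwa [← sq_abs, hl']
  have hTb : ∀ ω, ‖partialSum Z n ω‖ ≤ n * b := fun ω => by
    refine (norm_sum_le _ _).trans ((Finset.sum_le_sum fun i _ => hZb i ω).trans ?_)
    simp
  have hexpint : ∀ l' : ℝ, Integrable (fun ω => Real.exp (l' * ‖partialSum Z n ω‖)) μ := fun l' =>
    Integrable.of_bound (by fun_prop) (Real.exp (|l'| * (n * b))) (ae_of_all _ fun ω => by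
      rw [Real.norm_eq_abs, abs_of_pos (Real.exp_pos _)]
      refine Real.exp_le_exp.2 ?_
      exact mul_le_mul (le_abs_self _) (hTb ω) (norm_nonneg _) (abs_nonneg _))
  have hsmall : 3 / 4 ≤ μ.real {ω | ‖partialSum Z n ω‖ ≤ r / 8} := by
    have hcompl := probReal_compl_eq_one_sub (μ := μ)
      (measurableSet_le hTm.norm measurable_const : MeasurableSet {ω | ‖partialSum Z n ω‖ ≤ r / 8})
    have hle : μ.real {ω | ‖partialSum Z n ω‖ ≤ r / 8}ᶜ ≤
        μ.real {ω | r / 8 < ‖partialSum Y n ω‖} + μ.real U := by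
      refine le_trans (measureReal_mono fun ω hω => ?_) (measureReal_union_le _ _)
      by_cases hωU : ω ∈ U
      · exact Or.inr hωU
      · left
        simpa [hTS ω hωU] using hω
    linarith
  -- Were the mean larger, the lower deviation `‖T‖ ≤ r / 8` of the truncated sum `T` would have
  -- probability below `3 / 4`, against `hsmall`.
  have hmr : m ≤ r / 4 := by
    by_contra! hcon
    have h1 := measure_le_le_exp_mul_mgf (μ := μ) (X := fun ω => ‖partialSum Z n ω‖) (r / 8)
      (neg_nonpos.2 hl.le) (hexpint _)
    have h2 := mul_le_mul_of_nonneg_left (hmgf (-l) (by rw [abs_neg, abs_of_pos hl]))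
      (Real.exp_pos (- -l * (r / 8))).le
    rw [← Real.exp_add] at h2
    have h3 : - -l * (r / 8) + (M + -l * m) ≤ M - l * r / 8 := by nlinarith
    linarith [Real.exp_le_exp.2 h3]
  have hlarge : μ.real {ω | r ≤ ‖partialSum Z n ω‖} ≤ Real.exp (M - l * r / 8) := by
    have h1 := measure_ge_le_exp_mul_mgf (μ := μ) (X := fun ω => ‖partialSum Z n ω‖) r
      hl.le (hexpint _)
    have h2 := mul_le_mul_of_nonneg_left (hmgf l (abs_of_pos hl)) (Real.exp_pos (-l * r)).le
    rw [← Real.exp_add] at h2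
    have h3 : -l * r + (M + l * m) ≤ M - l * r / 8 := by
      have := mul_nonneg hl.le hr0
      nlinarith
    linarith [Real.exp_le_exp.2 h3]
  have hle : μ.real {ω | r < ‖partialSum Y n ω‖} ≤
      μ.real U + μ.real {ω | r ≤ ‖partialSum Z n ω‖} := by
    refine le_trans (measureReal_mono fun ω hω => ?_) (measureReal_union_le _ _)
    by_cases hωU : ω ∈ U
    · exact Or.inl hωU
    · right
      have : r < ‖partialSum Y n ω‖ := hω
      simpa [hTS ω hωU] using this.le
  linarith

/-- Under the weak law with normalization `n ^ (1 / p)`, the tail of the sum is at most `n` times the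
tail of a single term at a polynomially lower level, up to an arbitrary polynomial error. -/
theorem eventually_sum_tail_le {B Ω : Type*} [NormedAddCommGroup B]
    [SecondCountableTopology B] [MeasurableSpace B] [BorelSpace B] [MeasurableSpace Ω]
    {μ : Measure Ω} [IsProbabilityMeasure μ] {Y : ℕ → Ω → B} (hY : ∀ i, Measurable (Y i))
    (hind : iIndepFun Y μ) {V : ℝ → ℝ} (hV : ∀ i t, μ.real {ω | t < ‖Y i ω‖} = V t)
    {p : ℝ} (hp : 0 < p) (hp2 : p < 2)
    (hlln : ∀ s : ℝ, 0 < s → Tendsto (fun n : ℕ =>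
      μ.real {ω | s * (n : ℝ) ^ (1 / p) < ‖partialSum Y n ω‖}) atTop (𝓝 0))
    {s : ℝ} (hs : 0 < s) {ε : ℝ} (hε : 0 < ε) (K : ℝ) :
    ∀ᶠ n : ℕ in atTop, μ.real {ω | s * (n : ℝ) ^ (1 / p) < ‖partialSum Y n ω‖} ≤
      8 * (n * V ((n : ℝ) ^ (1 / p - ε))) + (n : ℝ) ^ K := by
  obtain ⟨C, hC0, hC⟩ := exists_tail_le_rpow_neg hY hind hV hp hlln
  -- With `b = n ^ (1/p - ε)` and `l = n ^ (δ - 1/p)`, this `δ` makes `n l² b ^ (2 - p) = 1`, so the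
  -- variance term stays equal to `M`. Also `l b ≤ 1` because `δ ≤ ε`, and `l s n ^ (1/p) = s n ^ δ`
  -- beats every multiple of `log n`.
  set δ : ℝ := (2 - p) * ε / 2 with hδ
  have hδ0 : 0 < δ := by
    have : 0 < 2 - p := by linarith
    positivity
  have hδε : δ ≤ ε := by nlinarith
  set M : ℝ := 2 * C / (2 - p) with hMdef
  have hcast : Tendsto (fun n : ℕ => (n : ℝ)) atTop atTop := tendsto_natCast_atTop_atTop
  have hnδ : Tendsto (fun n : ℕ => (n : ℝ) ^ δ) atTop atTop := (tendsto_rpow_atTop hδ0).comp hcast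
  have hsmall : ∀ K' : ℝ, ∀ᶠ n : ℕ in atTop,
      Real.exp (M - s * (n : ℝ) ^ δ / 8) ≤ (n : ℝ) ^ K' := fun K' => by
    have h := ((isLittleO_exp_neg_mul_rpow_atTop (by positivity : 0 < s / 8) (K' / δ)).comp_tendsto
      hnδ).def (Real.exp_pos (-M))
    filter_upwards [h, eventually_ge_atTop 1] with n hn hn1
    have hn0 : (0 : ℝ) < n := by exact_mod_cast hn1
    simp only [Function.comp_apply] at hn
    rw [Real.norm_eq_abs, Real.norm_eq_abs, abs_of_pos (Real.exp_pos _),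
      abs_of_nonneg (by positivity), ← Real.rpow_mul hn0.le, mul_div_cancel₀ _ hδ0.ne'] at hn
    have h2 := mul_le_mul_of_nonneg_left hn (Real.exp_pos M).le
    rw [← mul_assoc, ← Real.exp_add, ← Real.exp_add, add_neg_cancel, Real.exp_zero, one_mul] at h2
    rwa [show M - s * (n : ℝ) ^ δ / 8 = M + -(s / 8) * (n : ℝ) ^ δ by ring]
  filter_upwards [hsmall K, hsmall (-1), eventually_ge_atTop 2,
    (hlln (s / 8) (by positivity)).eventually_lt_const (by norm_num : (0 : ℝ) < 1 / 8)]
    with n h1 h2 hn2 h3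
  have hn2' : (2 : ℝ) ≤ n := by exact_mod_cast hn2
  have hn0 : (0 : ℝ) < n := by linarith
  have hKpos : 0 < (n : ℝ) ^ K := Real.rpow_pos_of_pos hn0 K
  -- When `n V(b) > 1/8` the right-hand side exceeds `1`; this case is the reason for the factor
  -- `8`.
  rcases le_or_gt (n * V ((n : ℝ) ^ (1 / p - ε))) (1 / 8) with hsm | hlg
  swap
  · have : μ.real {ω | s * (n : ℝ) ^ (1 / p) < ‖partialSum Y n ω‖} ≤ 1 := measureReal_le_one
    linarith
  set b : ℝ := (n : ℝ) ^ (1 / p - ε) with hbdef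
  have hb0 : 0 < b := Real.rpow_pos_of_pos hn0 _
  have hlr : (n : ℝ) ^ (δ - 1 / p) * (s * (n : ℝ) ^ (1 / p)) = s * (n : ℝ) ^ δ := by
    rw [mul_left_comm, ← Real.rpow_add hn0]
    congr 2
    ring
  have hVb : 0 ≤ V b := hV 0 b ▸ measureReal_nonneg
  have key := measureReal_sum_gt_upper_bound (r := s * (n : ℝ) ^ (1 / p)) (M := M)
    (l := (n : ℝ) ^ (δ - 1 / p)) (v := M * b ^ (2 - p)) hY hind hb0.le
    (Real.rpow_pos_of_pos hn0 _) ?_ n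
    (fun i => integral_norm_truncNorm_sq_le (hY i) hp2 hC0.le
      (fun t ht => (hV i t).trans_le (hC t ht)) hb0.le) ?_ (fun i => hV i b) hsm ?_ (by positivity) ?_
  · rw [hlr] at key
    linarith [mul_nonneg hn0.le hVb]
  · rw [hbdef, ← Real.rpow_add hn0]
    exact Real.rpow_le_one_of_one_le_of_nonpos (by linarith) (by linarith)
  · refine le_of_eq ?_
    have : (n : ℝ) * (((n : ℝ) ^ (δ - 1 / p)) ^ 2 * b ^ (2 - p)) = 1 := by
      rw [hbdef, ← Real.rpow_natCast, ← Real.rpow_mul hn0.le, ← Real.rpow_mul hn0.le,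
        ← Real.rpow_add hn0]
      nth_rewrite 1 [← Real.rpow_one (n : ℝ)]
      rw [← Real.rpow_add hn0]
      convert Real.rpow_zero (n : ℝ) using 2
      rw [hδ]
      field_simp
      push_cast
      ring
    linear_combination M * this
  · rw [show s * (n : ℝ) ^ (1 / p) / 8 = s / 8 * (n : ℝ) ^ (1 / p) by ring]
    exact h3.le
  · rw [hlr]
    refine h2.trans_lt ?_
    rw [Real.rpow_neg_one]
    have : (n : ℝ)⁻¹ ≤ 2⁻¹ := inv_anti₀ (by norm_num) hn2'
    linarith

/-! ### Passage between extended-real rates and real inequalities. -/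

/-- For real `x` the left side is `1 + x / p < c`. Testing against real thresholds confines the
infinite values to this lemma and the next. -/
theorem EReal.neg_neg_sub_div_lt_coe_iff {p : ℝ} (hp : 0 < p) (x : EReal) (c : ℝ) :
    -(-x - (p : EReal)) / (p : EReal) < c ↔ x < ((p * (c - 1) : ℝ) : EReal) := by
  induction x with
  | bot => simp [EReal.bot_div_of_pos_ne_top (EReal.coe_pos.2 hp) (EReal.coe_ne_top p),
      -EReal.coe_mul, -EReal.coe_sub]
  | top => simp [EReal.top_div_of_pos_ne_top (EReal.coe_pos.2 hp) (EReal.coe_ne_top p),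
      -EReal.coe_mul, -EReal.coe_sub]
  | coe x =>
    rw [← EReal.coe_neg, ← EReal.coe_sub, ← EReal.coe_neg, ← EReal.coe_div, EReal.coe_lt_coe_iff,
      EReal.coe_lt_coe_iff, div_lt_iff₀ hp]
    constructor <;> intro h <;> linarith

theorem EReal.coe_lt_neg_neg_sub_div_iff {p : ℝ} (hp : 0 < p) (x : EReal) (c : ℝ) :
    c < -(-x - (p : EReal)) / (p : EReal) ↔ ((p * (c - 1) : ℝ) : EReal) < x := by
  induction x with
  | bot => simp [EReal.bot_div_of_pos_ne_top (EReal.coe_pos.2 hp) (EReal.coe_ne_top p),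
      -EReal.coe_mul, -EReal.coe_sub]
  | top => simp [EReal.top_div_of_pos_ne_top (EReal.coe_pos.2 hp) (EReal.coe_ne_top p),
      -EReal.coe_mul, -EReal.coe_sub]
  | coe x =>
    rw [← EReal.coe_neg, ← EReal.coe_sub, ← EReal.coe_neg, ← EReal.coe_div, EReal.coe_lt_coe_iff,
      EReal.coe_lt_coe_iff, lt_div_iff₀ hp]
    constructor <;> intro h <;> linarith

theorem EReal.neg_sub_div_injective {p : ℝ} (hp : 0 < p) :
    Function.Injective fun x : EReal => -(x - (p : EReal)) / (p : EReal) := by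
  intro x y h
  simp only at h
  rw [← neg_neg x, ← neg_neg y] at h
  rw [← neg_inj]
  refine le_antisymm ?_ ?_ <;> refine EReal.le_of_forall_lt_iff_le.1 fun z hz => ?_
  -- The threshold `z / p + 1` is the solution `c` of `p (c - 1) = z`.
  · have h2 := (EReal.neg_neg_sub_div_lt_coe_iff hp (-y) (z / p + 1)).2
      (by rw [show p * (z / p + 1 - 1) = z by field_simp; ring]; exact hz)
    rw [← h, EReal.neg_neg_sub_div_lt_coe_iff hp,
      show p * (z / p + 1 - 1) = z by field_simp; ring] at h2
    exact h2.le
  · have h2 := (EReal.neg_neg_sub_div_lt_coe_iff hp (-x) (z / p + 1)).2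
      (by rw [show p * (z / p + 1 - 1) = z by field_simp; ring]; exact hz)
    rw [h, EReal.neg_neg_sub_div_lt_coe_iff hp,
      show p * (z / p + 1 - 1) = z by field_simp; ring] at h2
    exact h2.le

/-- This lets the estimates be made on real probabilities. A null event fits in, since `log 0 = ⊥`
and the exponential is positive. -/
theorem coe_one_div_mul_log_le_coe_iff {a : ℝ} (ha : 0 < a) {x : ENNReal} (hx : x ≠ ⊤) (c : ℝ) :
    ((1 / a : ℝ) : EReal) * ENNReal.log x ≤ c ↔ x.toReal ≤ Real.exp (a * c) := by
  have ha' : 0 < 1 / a := by positivity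
  rcases eq_or_ne x 0 with rfl | h0
  · simp only [ENNReal.log_zero, EReal.coe_mul_bot_of_pos ha', bot_le, ENNReal.toReal_zero,
      (Real.exp_pos _).le]
  · rw [ENNReal.log_pos_real h0 hx, ← EReal.coe_mul, EReal.coe_le_coe_iff, one_div,
      inv_mul_le_iff₀ ha, Real.log_le_iff_le_exp (ENNReal.toReal_pos h0 hx)]

theorem coe_le_coe_one_div_mul_log_iff {a : ℝ} (ha : 0 < a) {x : ENNReal} (hx : x ≠ ⊤) (c : ℝ) :
    c ≤ ((1 / a : ℝ) : EReal) * ENNReal.log x ↔ Real.exp (a * c) ≤ x.toReal := by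
  have ha' : 0 < 1 / a := by positivity
  rcases eq_or_ne x 0 with rfl | h0
  · simp [ENNReal.log_zero, EReal.coe_mul_bot_of_pos ha', Real.exp_pos, -one_div]
  · rw [ENNReal.log_pos_real h0 hx, ← EReal.coe_mul, EReal.coe_le_coe_iff, one_div,
      le_inv_mul_iff₀ ha, Real.le_log_iff_exp_le (ENNReal.toReal_pos h0 hx)]

/-- Comparison of the upper and lower limits of a sequence with those of a function of a real
variable, when upper bounds for the function give upper bounds for the sequence. -/
theorem limsup_le_and_liminf_le_of_transfer {f : ℝ → EReal} {R : ℕ → EReal} {p : ℝ} (hp : 0 < p)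
    (H : ∀ c c' : ℝ, c < c' → ∃ (N : ℝ → ℕ) (τ : ℕ → ℝ), Tendsto N atTop atTop ∧
      Tendsto τ atTop atTop ∧ (∀ᶠ n in atTop, N (τ n) = n) ∧
      ∀ᶠ t in atTop, f t ≤ ((p * (c - 1) : ℝ) : EReal) → R (N t) ≤ c') :
    limsup R atTop ≤ -(-limsup f atTop - (p : EReal)) / (p : EReal) ∧
      liminf R atTop ≤ -(-liminf f atTop - (p : EReal)) / (p : EReal) := by
  -- For the upper limit, `τ` reaches every large `n`, so an eventual bound on `f` transfers. For
  -- the lower limit, the bound on `f` holds only at arbitrarily large `t`, and `N` carries these to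
  -- arbitrarily large indices.
  constructor <;> by_contra! hcon <;> obtain ⟨c', hc1, hc'⟩ := EReal.lt_iff_exists_real_btwn.1 hcon
    <;> obtain ⟨c, hc, hcc'⟩ := EReal.lt_iff_exists_real_btwn.1 hc1
    <;> obtain ⟨N, τ, hN, hτ, hNτ, himp⟩ := H c c' (EReal.coe_lt_coe_iff.1 hcc')
    <;> rw [EReal.neg_neg_sub_div_lt_coe_iff hp] at hc
  · refine absurd hc' (not_lt.2 ?_)
    refine limsup_le_of_le (by isBoundedDefault) ?_
    filter_upwards [hNτ, hτ.eventually himp, hτ.eventually (eventually_lt_of_limsup_lt hc)]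
      with n h1 h2 h3
    rw [h1] at h2
    exact h2 h3.le
  · have h1 := hN.eventually (eventually_lt_of_lt_liminf hc')
    obtain ⟨t, ht1, ht2, ht3⟩ :=
      ((frequently_lt_of_liminf_lt (by isBoundedDefault) hc).and_eventually (h1.and himp)).exists
    exact absurd (ht3 ht1.le) (not_le.2 ht2)

/-- Comparison of the upper and lower limits of a sequence with those of a function of a real
variable, when lower bounds for the function give lower bounds for the sequence. -/
theorem le_limsup_and_le_liminf_of_transfer {f : ℝ → EReal} {R : ℕ → EReal} {p : ℝ} (hp : 0 < p)
    (H : ∀ c c' : ℝ, c < c' → ∃ (N : ℝ → ℕ) (τ : ℕ → ℝ), Tendsto N atTop atTop ∧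
      Tendsto τ atTop atTop ∧ (∀ᶠ n in atTop, N (τ n) = n) ∧
      ∀ᶠ t in atTop, ((p * (c' - 1) : ℝ) : EReal) ≤ f t → c ≤ R (N t)) :
    -(-limsup f atTop - (p : EReal)) / (p : EReal) ≤ limsup R atTop ∧
      -(-liminf f atTop - (p : EReal)) / (p : EReal) ≤ liminf R atTop := by
  constructor <;> by_contra! hcon <;> obtain ⟨c, hc, hc1⟩ := EReal.lt_iff_exists_real_btwn.1 hcon
    <;> obtain ⟨c', hcc', hc'⟩ := EReal.lt_iff_exists_real_btwn.1 hc1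
    <;> obtain ⟨N, τ, hN, hτ, hNτ, himp⟩ := H c c' (EReal.coe_lt_coe_iff.1 hcc')
    <;> rw [EReal.coe_lt_neg_neg_sub_div_iff hp] at hc'
  · have h1 := hN.eventually (eventually_lt_of_limsup_lt hc)
    obtain ⟨t, ht1, ht2, ht3⟩ :=
      ((frequently_lt_of_lt_limsup (by isBoundedDefault) hc').and_eventually (h1.and himp)).exists
    exact absurd (ht3 ht1.le) (not_le.2 ht2)
  · refine absurd hc (not_lt.2 ?_)
    refine le_liminf_of_le (by isBoundedDefault) ?_
    filter_upwards [hNτ, hτ.eventually himp, hτ.eventually (eventually_lt_of_lt_liminf hc')]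
      with n h1 h2 h3
    rw [h1] at h2
    exact h2 h3.le

theorem tendsto_log_natCast_atTop : Tendsto (fun n : ℕ => Real.log n) atTop atTop :=
  Real.tendsto_log_atTop.comp tendsto_natCast_atTop_atTop

/-! ### Change of variable between `t` and `n`. -/

/-- Exponential upper bounds for `V ∘ exp` give polynomial upper bounds for `P`. -/
theorem exists_transfer_upper {V : ℝ → ℝ} {P : ℕ → ℝ} (hV : Antitone V) {p : ℝ} (hp : 0 < p)
    (hP : ∀ ε K : ℝ, 0 < ε → ∀ᶠ n : ℕ in atTop,
      P n ≤ 8 * (n * V ((n : ℝ) ^ (1 / p - ε))) + (n : ℝ) ^ K) {c c' : ℝ} (hcc : c < c') :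
    ∃ (N : ℝ → ℕ) (τ : ℕ → ℝ), Tendsto N atTop atTop ∧
      Tendsto τ atTop atTop ∧ (∀ᶠ n in atTop, N (τ n) = n) ∧
      ∀ᶠ t in atTop, V (Real.exp t) ≤ Real.exp (t * (p * (c - 1))) →
        P (N t) ≤ Real.exp (Real.log (N t) * c') := by
  -- Half of the gap `c' - c` pays for replacing the exponent `1/p` by `1/p - ε`; the other half
  -- absorbs the constants, as `log n → ∞`.
  obtain ⟨ε, hε0, hεp, hεc⟩ : ∃ ε : ℝ, 0 < ε ∧ p * ε < 1 ∧ p * ε * |c - 1| ≤ (c' - c) / 2 := by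
    have h1 : 0 < (c' - c) / (2 * (|c - 1| + 1)) := div_pos (by linarith) (by positivity)
    refine ⟨min (1 / 2) ((c' - c) / (2 * (|c - 1| + 1))) / p,
      div_pos (lt_min (by norm_num) h1) hp, ?_, ?_⟩
    · rw [mul_div_cancel₀ _ hp.ne']
      exact (min_le_left _ _).trans_lt (by norm_num)
    · rw [mul_div_cancel₀ _ hp.ne']
      refine (mul_le_mul_of_nonneg_right (min_le_right _ _) (abs_nonneg _)).trans ?_
      rw [div_mul_eq_mul_div, div_le_div_iff₀ (by positivity) (by norm_num)]
      nlinarith [abs_nonneg (c - 1)]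
  set κ : ℝ := 1 / p - ε with hκ
  have hκp : κ * p = 1 - p * ε := by
    rw [hκ]; field_simp
  have hκ0 : 0 < κ := by
    have : 0 < κ * p := by rw [hκp]; linarith
    exact pos_of_mul_pos_left this hp.le
  -- Rounding up ensures `n ^ κ ≥ exp t`, hence `V (n ^ κ) ≤ V (exp t)`. It moves `log n` by at most
  -- `log 2`.
  have hN : Tendsto (fun t : ℝ => ⌈Real.exp (t / κ)⌉₊) atTop atTop :=
    tendsto_nat_ceil_atTop.comp (Real.tendsto_exp_atTop.comp (tendsto_id.atTop_div_const hκ0))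
  refine ⟨fun t => ⌈Real.exp (t / κ)⌉₊, fun n => κ * Real.log n, hN,
    tendsto_log_natCast_atTop.const_mul_atTop hκ0, ?_, ?_⟩
  · filter_upwards [eventually_gt_atTop 0] with n hn
    rw [mul_div_cancel_left₀ _ hκ0.ne', Real.exp_log (by exact_mod_cast hn), Nat.ceil_natCast]
  -- Here `16 = 8 · 2`: the main term and the error `n ^ (c' - 1)` each receive half of `n ^ c'`.
  have hev := (tendsto_log_natCast_atTop.const_mul_atTop
    (by linarith : 0 < (c' - c) / 2)).eventually_ge_atTop
    (Real.log 16 + κ * p * |c - 1| * Real.log 2)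
  filter_upwards [hN.eventually (hP ε (c' - 1) hε0), hN.eventually hev,
    hN.eventually (eventually_ge_atTop 2), eventually_ge_atTop 0] with t h1 h2 h3 ht0 hVt
  have hle : Real.exp (t / κ) ≤ (⌈Real.exp (t / κ)⌉₊ : ℝ) := Nat.le_ceil _
  have hlt : (⌈Real.exp (t / κ)⌉₊ : ℝ) < Real.exp (t / κ) + 1 := Nat.ceil_lt_add_one (Real.exp_pos _).le
  have h1le : 1 ≤ Real.exp (t / κ) := Real.one_le_exp (by positivity)
  generalize ⌈Real.exp (t / κ)⌉₊ = n at *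
  have hn2 : (2 : ℝ) ≤ n := by exact_mod_cast h3
  have hn0 : (0 : ℝ) < n := by linarith
  set ℓ : ℝ := Real.log n with hℓ
  have hnℓ : (n : ℝ) = Real.exp ℓ := (Real.exp_log hn0).symm
  have ht1 : t ≤ κ * ℓ := by
    have := (Real.le_log_iff_exp_le hn0).2 hle
    rw [div_le_iff₀ hκ0] at this
    linarith
  have ht2 : κ * (ℓ - Real.log 2) ≤ t := by
    have h : ℓ ≤ Real.log (2 * Real.exp (t / κ)) := Real.log_le_log hn0 (by linarith)
    rw [Real.log_mul (by norm_num) (Real.exp_pos _).ne', Real.log_exp] at h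
    have h' : ℓ - Real.log 2 ≤ t / κ := by linarith
    rw [le_div_iff₀ hκ0] at h'
    linarith
  have hVn : V ((n : ℝ) ^ κ) ≤ Real.exp (t * (p * (c - 1))) := by
    refine (hV ?_).trans hVt
    rw [Real.rpow_def_of_pos hn0]
    exact Real.exp_le_exp.2 (by linarith)
  have hKn : (n : ℝ) ^ (c' - 1) ≤ Real.exp (ℓ * c') / 2 := by
    rw [Real.rpow_sub hn0, Real.rpow_one, Real.rpow_def_of_pos hn0]
    exact div_le_div_of_nonneg_left (Real.exp_pos _).le (by norm_num) hn2
  have hmain : 8 * (n * V ((n : ℝ) ^ κ)) ≤ Real.exp (ℓ * c') / 2 := by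
    have hstep : Real.log 16 + (ℓ + t * (p * (c - 1))) ≤ ℓ * c' := by
      have hℓ0 : 0 ≤ ℓ := Real.log_nonneg (by linarith)
      have ha : (t - κ * ℓ) * (p * (c - 1)) ≤ κ * Real.log 2 * (p * |c - 1|) := by
        refine (le_abs_self _).trans ?_
        rw [abs_mul, abs_mul, abs_of_pos hp]
        refine mul_le_mul_of_nonneg_right ?_ (by positivity)
        rw [abs_le]
        constructor <;> linarith
      have hb : -(p * ε * (c - 1)) ≤ (c' - c) / 2 := by
        refine le_trans ?_ hεc
        have := mul_le_mul_of_nonneg_left (neg_le_abs (c - 1)) (by positivity : 0 ≤ p * ε)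
        linarith
      have hb' := mul_le_mul_of_nonneg_left hb hℓ0
      have hid : κ * ℓ * (p * (c - 1)) = ℓ * (c - 1) - ℓ * (p * ε * (c - 1)) := by
        linear_combination ℓ * (c - 1) * hκp
      nlinarith
    have hexp := Real.exp_le_exp.2 hstep
    rw [Real.exp_add, Real.exp_log (by norm_num), Real.exp_add, ← hnℓ] at hexp
    have := mul_le_mul_of_nonneg_left hVn hn0.le
    linarith
  linarith

/-- Exponential lower bounds for `V ∘ exp` give polynomial lower bounds for `P`. -/
theorem exists_transfer_lower {V : ℝ → ℝ} {P : ℕ → ℝ} (hV : Antitone V) {p s : ℝ} (hp : 0 < p)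
    (hs : 0 < s) (hP : ∀ᶠ n : ℕ in atTop, n * V (2 * s * (n : ℝ) ^ (1 / p)) / 8 ≤ P n)
    {c c' : ℝ} (hcc : c < c') :
    ∃ (N : ℝ → ℕ) (τ : ℕ → ℝ), Tendsto N atTop atTop ∧
      Tendsto τ atTop atTop ∧ (∀ᶠ n in atTop, N (τ n) = n) ∧
      ∀ᶠ t in atTop, Real.exp (t * (p * (c' - 1))) ≤ V (Real.exp t) →
        Real.exp (Real.log (N t) * c) ≤ P (N t) := by
  -- Rounding down ensures `2 s n ^ (1/p) ≤ exp t`, the direction that a lower bound on the antitone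
  -- `V` requires.
  have hN : Tendsto (fun t : ℝ => ⌊(Real.exp t / (2 * s)) ^ p⌋₊) atTop atTop :=
    tendsto_nat_floor_atTop.comp ((tendsto_rpow_atTop hp).comp
      (Real.tendsto_exp_atTop.atTop_div_const (by positivity)))
  have hτ : Tendsto (fun n : ℕ => Real.log (2 * s * (n : ℝ) ^ (1 / p))) atTop atTop :=
    Real.tendsto_log_atTop.comp (((tendsto_rpow_atTop (by positivity)).comp
      tendsto_natCast_atTop_atTop).const_mul_atTop (by positivity))
  refine ⟨_, _, hN, hτ, ?_, ?_⟩
  · filter_upwards [eventually_gt_atTop 0] with n hn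
    have hn0 : (0 : ℝ) < n := by exact_mod_cast hn
    rw [Real.exp_log (by positivity), mul_div_cancel_left₀ _ (by positivity),
      ← Real.rpow_mul hn0.le, one_div_mul_cancel hp.ne', Real.rpow_one, Nat.floor_natCast]
  set d : ℝ := Real.log (2 * s) with hd
  have hev := (tendsto_log_natCast_atTop.const_mul_atTop
    (by linarith : 0 < c' - c)).eventually_ge_atTop
    (Real.log 8 + (Real.log 2 + p * |d|) * |c' - 1|)
  filter_upwards [hN.eventually hP, hN.eventually hev,
    hN.eventually (eventually_ge_atTop 1)] with t h1 h2 h3 hVt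
  set y : ℝ := (Real.exp t / (2 * s)) ^ p with hy
  have hy0 : 0 < y := by positivity
  have hle : (⌊y⌋₊ : ℝ) ≤ y := Nat.floor_le hy0.le
  have hlt : y < (⌊y⌋₊ : ℝ) + 1 := Nat.lt_floor_add_one y
  generalize ⌊y⌋₊ = n at *
  have hn1 : (1 : ℝ) ≤ n := by exact_mod_cast h3
  have hn0 : (0 : ℝ) < n := by linarith
  set ℓ : ℝ := Real.log n with hℓ
  have hnℓ : (n : ℝ) = Real.exp ℓ := (Real.exp_log hn0).symm
  have hlogy : Real.log y = p * (t - d) := by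
    rw [hy, Real.log_rpow (by positivity), Real.log_div (Real.exp_pos t).ne' (by positivity),
      Real.log_exp]
  have ht1 : ℓ ≤ p * (t - d) := hlogy ▸ Real.log_le_log hn0 hle
  have ht2 : p * (t - d) ≤ Real.log 2 + ℓ := by
    rw [← hlogy, ← Real.log_mul (by norm_num) hn0.ne']
    exact Real.log_le_log hy0 (by linarith)
  have hVn : Real.exp (t * (p * (c' - 1))) ≤ V (2 * s * (n : ℝ) ^ (1 / p)) := by
    refine hVt.trans (hV ?_)
    have : (n : ℝ) ^ (1 / p) ≤ Real.exp t / (2 * s) := by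
      calc (n : ℝ) ^ (1 / p) ≤ y ^ (1 / p) := Real.rpow_le_rpow hn0.le hle (by positivity)
        _ = _ := by
          rw [hy, ← Real.rpow_mul (by positivity), mul_one_div_cancel hp.ne', Real.rpow_one]
    rw [le_div_iff₀ (by positivity)] at this
    linarith
  have hstep : Real.log 8 + ℓ * c ≤ ℓ + t * (p * (c' - 1)) := by
    have hlog2 : 0 ≤ Real.log 2 := Real.log_nonneg (by norm_num)
    have ha : -((p * t - ℓ) * (c' - 1)) ≤ (Real.log 2 + p * |d|) * |c' - 1| := by
      refine (neg_le_abs _).trans ?_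
      rw [abs_mul]
      refine mul_le_mul_of_nonneg_right ?_ (abs_nonneg _)
      have e1 := mul_le_mul_of_nonneg_left (le_abs_self d) hp.le
      have e2 := mul_le_mul_of_nonneg_left (neg_le_abs d) hp.le
      rw [abs_le]
      constructor <;> linarith
    linarith
  have hexp := Real.exp_le_exp.2 hstep
  rw [Real.exp_add, Real.exp_log (by norm_num), Real.exp_add, ← hnℓ] at hexp
  have := mul_le_mul_of_nonneg_left hVn hn0.le
  linarith

/-! ### Assembly of the two bounds. -/

/-- The asymptotic identities for a sequence of measurable representatives, in terms of the common
tail function of the norms. -/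
theorem limsup_liminf_logDeviationRate {B Ω : Type*} [NormedAddCommGroup B]
    [SecondCountableTopology B] [MeasurableSpace B] [BorelSpace B] [MeasurableSpace Ω]
    {μ : Measure Ω} [IsProbabilityMeasure μ] {X : Ω → B} {Y : ℕ → Ω → B}
    (hY : ∀ i, Measurable (Y i)) (hind : iIndepFun Y μ) (hident : ∀ i, IdentDistrib (Y i) X μ μ)
    {p : ℝ} (hp : 0 < p) (hp2 : p < 2)
    (hlln : ∀ s : ℝ, 0 < s → Tendsto (fun n : ℕ =>
      μ.real {ω | s * (n : ℝ) ^ (1 / p) < ‖partialSum Y n ω‖}) atTop (𝓝 0))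
    {s : ℝ} (hs : 0 < s) :
    limsup (fun n : ℕ => logDeviationRate μ Y p s n) atTop
        = -(upperTailExponent μ X - (p : EReal)) / (p : EReal) ∧
      liminf (fun n : ℕ => logDeviationRate μ Y p s n) atTop
        = -(lowerTailExponent μ X - (p : EReal)) / (p : EReal) := by
  set V : ℝ → ℝ := fun t => μ.real {ω | t < ‖X ω‖} with hVdef
  have hV : ∀ i t, μ.real {ω | t < ‖Y i ω‖} = V t := fun i t =>
    congrArg ENNReal.toReal ((hident i).measure_mem_eq (s := {x | t < ‖x‖})
      (measurableSet_lt measurable_const measurable_norm))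
  have hVanti : Antitone V := fun a b hab => measureReal_mono fun ω hω => lt_of_le_of_lt hab hω
  have hVexp : ∀ t : ℝ, 0 < t → (μ {ω | Real.log ‖X ω‖ > t}).toReal = V (Real.exp t) := by
    intro t ht
    refine congrArg (fun A => (μ A).toReal) (Set.ext fun ω => ?_)
    change t < Real.log ‖X ω‖ ↔ Real.exp t < ‖X ω‖
    -- At `X ω = 0` the default `Real.log 0 = 0` is harmless because `t > 0`.
    rcases (norm_nonneg (X ω)).eq_or_lt with h | h
    · rw [← h, Real.log_zero]
      exact iff_of_false ht.not_gt (Real.exp_pos t).not_gt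
    · exact Real.lt_log_iff_exp_lt h
  have hlog : ∀ n : ℕ, 2 ≤ n → 0 < Real.log n := fun n hn =>
    Real.log_pos (by exact_mod_cast (by omega : 1 < n))
  have hup := limsup_le_and_liminf_le_of_transfer (f := fun t => logTailRate μ X t)
    (R := fun n => logDeviationRate μ Y p s n) hp fun c c' hcc => by
      obtain ⟨N, τ, hN, hτ, hNτ, h⟩ := exists_transfer_upper hVanti hp
        (fun ε K hε => eventually_sum_tail_le hY hind hV hp hp2 hlln hs hε K) hcc
      refine ⟨N, τ, hN, hτ, hNτ, ?_⟩
      filter_upwards [h, eventually_gt_atTop 0, hN.eventually (eventually_ge_atTop 2)]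
        with t ht ht0 hNt hrate
      refine (coe_one_div_mul_log_le_coe_iff (hlog _ hNt) (measure_ne_top _ _) _).2 (ht ?_)
      rw [← hVexp t ht0]
      exact (coe_one_div_mul_log_le_coe_iff ht0 (measure_ne_top _ _) _).1 hrate
  have hlow := le_limsup_and_le_liminf_of_transfer (f := fun t => logTailRate μ X t)
    (R := fun n => logDeviationRate μ Y p s n) hp fun c c' hcc => by
      obtain ⟨N, τ, hN, hτ, hNτ, h⟩ := exists_transfer_lower hVanti hp hs
        ((eventually_tail_le_sum_tail hY hind hV hp hlln hs).mono fun n hn => hn.2) hcc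
      refine ⟨N, τ, hN, hτ, hNτ, ?_⟩
      filter_upwards [h, eventually_gt_atTop 0, hN.eventually (eventually_ge_atTop 2)]
        with t ht ht0 hNt hrate
      refine (coe_le_coe_one_div_mul_log_iff (hlog _ hNt) (measure_ne_top _ _) _).2 (ht ?_)
      rw [← hVexp t ht0]
      exact (coe_le_coe_one_div_mul_log_iff ht0 (measure_ne_top _ _) _).1 hrate
  exact ⟨le_antisymm hup.1 hlow.1, le_antisymm hup.2 hlow.2⟩

theorem theorem2p1 {B : Type*} [NormedAddCommGroup B] [NormedSpace ℝ B] [CompleteSpace B]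
    [TopologicalSpace.SeparableSpace B] [MeasurableSpace B] [BorelSpace B]
    {Ω : Type*} [MeasurableSpace Ω] (μ : Measure Ω) [IsProbabilityMeasure μ]
    (p : ℝ) (hp0 : 0 < p) (hp2 : p < 2)
    (X : Ω → B) (Y : ℕ → Ω → B)
    (hindep : iIndepFun Y μ) (hident : ∀ i, IdentDistrib (Y i) X μ μ)
    (hwlln : TendstoInMeasure μ
      (fun (n : ℕ) (ω : Ω) => ((n : ℝ) ^ (1 / p))⁻¹ • partialSum Y n ω) atTop
      (fun _ => (0 : B))) :
    ∀ s : ℝ, 0 < s →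
      limsup (fun n : ℕ => logDeviationRate μ Y p s n) atTop
          = -(upperTailExponent μ X - (p : EReal)) / (p : EReal) ∧
      liminf (fun n : ℕ => logDeviationRate μ Y p s n) atTop
          = -(lowerTailExponent μ X - (p : EReal)) / (p : EReal) ∧
      ∀ β : EReal,
        Tendsto (fun n : ℕ => logDeviationRate μ Y p s n) atTop
            (𝓝 (-(β - (p : EReal)) / (p : EReal))) ↔
          upperTailExponent μ X = lowerTailExponent μ X ∧ lowerTailExponent μ X = β := by
  
  have : SecondCountableTopology B := UniformSpace.secondCountable_of_separable B
  have hae : ∀ i, Y i =ᵐ[μ] (hident i).aemeasurable_fst.mk := fun i =>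
    (hident i).aemeasurable_fst.ae_eq_mk
  -- `IdentDistrib` gives only a.e. measurability; measurable versions leave all the probabilities
  -- unchanged.
  set Y' : ℕ → Ω → B := fun i => (hident i).aemeasurable_fst.mk with hY'
  have hmeas : ∀ i, Measurable (Y' i) := fun i => (hident i).aemeasurable_fst.measurable_mk
  have hsum : ∀ n, partialSum Y n =ᵐ[μ] partialSum Y' n := fun n => by
    filter_upwards [ae_all_iff.2 hae] with ω hω
    exact Finset.sum_congr rfl fun i _ => hω i
  have hmeasure : ∀ (n : ℕ) (r : ℝ),
      μ {ω | r < ‖partialSum Y n ω‖} = μ {ω | r < ‖partialSum Y' n ω‖} := fun n r => by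
    refine measure_congr ?_
    filter_upwards [hsum n] with ω hω
    change (r < ‖partialSum Y n ω‖) = (r < ‖partialSum Y' n ω‖)
    rw [hω]
  have hlln : ∀ s : ℝ, 0 < s → Tendsto (fun n : ℕ =>
      μ.real {ω | s * (n : ℝ) ^ (1 / p) < ‖partialSum Y' n ω‖}) atTop (𝓝 0) := fun s hs => by
    refine tendsto_of_tendsto_of_tendsto_of_le_of_le' tendsto_const_nhds
      (tendstoInMeasure_iff_measureReal_norm.1 hwlln s hs)
      (Eventually.of_forall fun n => measureReal_nonneg) ?_
    filter_upwards [eventually_gt_atTop 0] with n hn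
    have hn0 : (0 : ℝ) < (n : ℝ) ^ (1 / p) := Real.rpow_pos_of_pos (by exact_mod_cast hn) _
    rw [measureReal_def, ← hmeasure, ← measureReal_def]
    refine measureReal_mono fun ω hω => ?_
    have hω' : s * (n : ℝ) ^ (1 / p) < ‖partialSum Y n ω‖ := hω
    change s ≤ _
    rw [sub_zero, norm_smul, norm_inv, Real.norm_of_nonneg hn0.le, le_inv_mul_iff₀ hn0]
    linarith
  intro s hs
  have hrate : (fun n : ℕ => logDeviationRate μ Y p s n) =
      fun n : ℕ => logDeviationRate μ Y' p s n :=
    funext fun n => congrArg (fun x => ((1 / Real.log n : ℝ) : EReal) * ENNReal.log x) (hmeasure n _)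
  obtain ⟨h1, h2⟩ := limsup_liminf_logDeviationRate hmeas (hindep.congr hae)
    (fun i => (IdentDistrib.of_ae_eq (hident i).aemeasurable_fst (hae i)).symm.trans (hident i))
    hp0 hp2 hlln hs
  rw [← hrate] at h1 h2
  refine ⟨h1, h2, fun β => ⟨fun h => ?_, fun ⟨h3, h4⟩ => ?_⟩⟩
  -- A limit is both the upper and the lower limit, and `β ↦ -(β - p) / p` is injective on `[-∞,
  -- ∞]`, so both exponents equal `β`.
  · have hu := EReal.neg_sub_div_injective hp0 (h1.symm.trans h.limsup_eq)
    have hl := EReal.neg_sub_div_injective hp0 (h2.symm.trans h.liminf_eq)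
    exact ⟨hu.trans hl.symm, hl⟩
  · rw [h3, h4] at h1
    rw [h4] at h2
    exact tendsto_of_liminf_eq_limsup h2 h1
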